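/- For a permutation $w = w_1 w_2 \cdots w_n \in \mathfrak{S}_n$, let $\mathrm{as}(w)$ be the largest $k$ for which there are indices $i_1 < i_2 < \cdots < i_k$ with $w_{i_1} > w_{i_2} < w_{i_3} > w_{i_4} < \cdots w_{i_k}$ (the length of the longest alternating subsequence of $w$; an alternating sequence with at least two terms must begin with a descent). For $j \ge 0$ let $$\nu_j(n) = \frac{1}{n!}\sum_{w \in \mathfrak{S}_n} \mathrm{as}(w)\,(\mathrm{as}(w)-1)\cdots(\mathrm{as}(w)-j+1)$$ be the $j$-th factorial moment, and let $\mathrm{var}(\mathrm{as}_n)$ be the variance of $\mathrm{as}(w)$ when $w$ is chosen uniformly at random from $\mathfrak{S}_n$. Then $\mathrm{var}(\mathrm{as}_n) = \nu_2(n) + \nu_1(n) - \nu_1(n)^2$ for all $n\ge 0$, and for all $n \ge 4$ $$\nu_2(n) = \frac{40n^2 - 24n - 19}{90}, \qquad \mathrm{var}(\mathrm{as}_n) = \frac{32n - 13}{180} = \frac{8}{45}\,n - \frac{13}{180}.$$ -/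

import Mathlib

open MeasureTheory ProbabilityTheory

/-- A finite sequence `v 0, v 1, …, v (k-1)` is alternating if
`v 0 > v 1 < v 2 > v 3 < ⋯`; a sequence of length at least two begins with a descent. -/
def IsAlternating {k n : ℕ} (v : Fin k → Fin n) : Prop :=
  ∀ i j : Fin k, (i : ℕ) + 1 = (j : ℕ) →
    (Even (i : ℕ) → v j < v i) ∧ (Odd (i : ℕ) → v i < v j)

/-- The permutation `w`, read as the word `w 0, w 1, …, w (n-1)`, has an alternating
subsequence with `k` terms, at the positions `p 0 < p 1 < ⋯ < p (k-1)`. -/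
def HasAlternatingSubseq {n : ℕ} (w : Equiv.Perm (Fin n)) (k : ℕ) : Prop :=
  ∃ p : Fin k → Fin n, StrictMono p ∧ IsAlternating (fun i => w (p i))

/-- The number of terms of the longest alternating subsequence of `w`. -/
noncomputable def longestAlternating {n : ℕ} (w : Equiv.Perm (Fin n)) : ℕ :=
  sSup {k : ℕ | HasAlternatingSubseq w k}

theorem HasAlternatingSubseq.le {n k : ℕ} {w : Equiv.Perm (Fin n)}
    (h : HasAlternatingSubseq w k) : k ≤ n := by
  obtain ⟨p, hp, -⟩ := h
  simpa using Fintype.card_le_of_injective p hp.injective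

/-- The set of lengths is nonempty and bounded, so the supremum above is a maximum. -/
theorem isGreatest_longestAlternating {n : ℕ} (w : Equiv.Perm (Fin n)) :
    IsGreatest {k : ℕ | HasAlternatingSubseq w k} (longestAlternating w) := by
  have hb : BddAbove {k : ℕ | HasAlternatingSubseq w k} := ⟨n, fun _ h => h.le⟩
  have hne : {k : ℕ | HasAlternatingSubseq w k}.Nonempty :=
    ⟨0, Fin.elim0, fun i => i.elim0, fun i => i.elim0⟩
  exact ⟨Nat.sSup_mem hne hb, fun _ h => le_csSup hb h⟩

/-- The factorial moment `ν_j(n) = (1/n!) ∑_w as(w) (as(w) - 1) ⋯ (as(w) - j + 1)`. -/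
noncomputable def factorialMoment (j n : ℕ) : ℝ :=
  (∑ w : Equiv.Perm (Fin n), ((longestAlternating w).descFactorial j : ℝ)) / (n.factorial : ℝ)

/-- The variance of the random variable `as_n`, the length of the longest alternating
subsequence of a uniformly distributed random permutation. -/
noncomputable def varianceLongestAlternating (n : ℕ) : ℝ :=
  letI : MeasurableSpace (Equiv.Perm (Fin n)) := ⊤
  variance (fun w : Equiv.Perm (Fin n) => (longestAlternating w : ℝ))
    (PMF.uniformOfFintype (Equiv.Perm (Fin n))).toMeasure

/-! The length `as(w)` is local: it equals 1 plus the number of direction changes of the word,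
preceded by a fictitious ascent (`longestAlternating_eq_turnLength`). So it is a sum of indicators,
each depending on the relative order of at most three consecutive letters. Patterns on a window are
uniform and independent of the letters outside it (`sum_orderPattern_mul`). Hence turns on disjoint
windows are uncorrelated, and overlapping ones reduce to counts in `S_3`, `S_4`, `S_5`. Adding one
letter at a time gives a recursion for the second moment (`sum_turnLength_sq`), and the variance
follows from `E[X²] = ν_2 + ν_1`. -/

/-! ### Averaging over the relative order of a few entries -/

/-- The relative order of a finite sequence. -/
def orderPattern {k n : ℕ} (u : Fin k → Fin n) : Fin k → Fin k → Bool :=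
  fun a b => decide (u a < u b)

theorem exists_perm_orderPattern_eq {k n : ℕ} (u : Fin k → Fin n) (hu : Function.Injective u) :
    ∃ σ : Equiv.Perm (Fin k), ∀ a b, u a < u b ↔ σ a < σ b := by
  have hcard : (Finset.univ.image u).card = k := by
    rw [Finset.card_image_of_injective _ hu, Finset.card_fin]
  let e := (Finset.univ.image u).orderIsoOfFin hcard
  let g : Fin k → Fin k := fun a => e.symm ⟨u a, Finset.mem_image_of_mem u (Finset.mem_univ a)⟩
  have hg : ∀ a b, u a < u b ↔ g a < g b := by
    intro a b
    simp only [g, OrderIso.lt_iff_lt, Subtype.mk_lt_mk]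
  have hinj : Function.Injective g := by
    intro a b hab
    simp only [g, EmbeddingLike.apply_eq_iff_eq, Subtype.mk.injEq] at hab
    exact hu hab
  exact ⟨Equiv.ofBijective g (Finite.injective_iff_bijective.mp hinj), hg⟩

/-- The relative order of the entries at `k` chosen positions is uniformly distributed, and
independent of every function of the entries at the other positions. -/
theorem sum_orderPattern_mul {k n : ℕ} (p : Fin k ↪ Fin n) (F : (Fin k → Fin k → Bool) → ℕ)
    (G : Equiv.Perm (Fin n) → ℕ)
    (hG : ∀ w w' : Equiv.Perm (Fin n), (∀ x ∉ Set.range p, w x = w' x) → G w = G w') :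
    k.factorial * ∑ w : Equiv.Perm (Fin n), F (orderPattern (w ∘ p)) * G w =
      (∑ σ : Equiv.Perm (Fin k), F (orderPattern σ)) * ∑ w, G w := by
  -- Permuting the chosen positions by `τ` is a bijection of the sum that leaves `G` unchanged.
  have hshift : ∀ τ : Equiv.Perm (Fin k),
      ∑ w : Equiv.Perm (Fin n), F (orderPattern (w ∘ p)) * G w =
        ∑ w : Equiv.Perm (Fin n), F (orderPattern (w ∘ p ∘ τ)) * G w := by
    intro τ
    rw [← Equiv.sum_comp (Equiv.mulRight (τ.viaFintypeEmbedding p))]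
    refine Finset.sum_congr rfl fun w _ => ?_
    have h1 : (⇑(w * τ.viaFintypeEmbedding p) ∘ p : Fin k → Fin n) = w ∘ p ∘ τ := by
      funext a
      simp [Equiv.Perm.viaFintypeEmbedding_apply_image]
    have h2 : G (w * τ.viaFintypeEmbedding p) = G w := by
      refine hG _ _ fun x hx => ?_
      simp [Equiv.Perm.viaFintypeEmbedding_apply_notMem_range _ _ hx]
    simp only [Equiv.coe_mulRight, h1, h2]
  -- The chosen letters are ordered like some `ρ`, and `ρ * τ` runs through the whole group with
  -- `τ`.
  have hinner : ∀ w : Equiv.Perm (Fin n),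
      ∑ τ : Equiv.Perm (Fin k), F (orderPattern (w ∘ p ∘ τ)) =
        ∑ σ : Equiv.Perm (Fin k), F (orderPattern σ) := by
    intro w
    obtain ⟨ρ, hρ⟩ := exists_perm_orderPattern_eq (w ∘ p) (w.injective.comp p.injective)
    rw [← Equiv.sum_comp (Equiv.mulLeft ρ) (fun σ => F (orderPattern σ))]
    refine Finset.sum_congr rfl fun τ _ => congrArg F ?_
    funext a b
    exact decide_eq_decide.mpr (hρ (τ a) (τ b))
  calc k.factorial * ∑ w : Equiv.Perm (Fin n), F (orderPattern (w ∘ p)) * G w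
      = ∑ τ : Equiv.Perm (Fin k), ∑ w : Equiv.Perm (Fin n),
          F (orderPattern (w ∘ p ∘ τ)) * G w := by
        rw [← Finset.sum_congr rfl fun τ _ => hshift τ, Finset.sum_const, Finset.card_univ,
          Fintype.card_perm, Fintype.card_fin, smul_eq_mul]
    _ = ∑ w : Equiv.Perm (Fin n), (∑ σ : Equiv.Perm (Fin k), F (orderPattern σ)) * G w := by
        rw [Finset.sum_comm]
        refine Finset.sum_congr rfl fun w _ => ?_
        rw [← Finset.sum_mul, hinner]
    _ = _ := by rw [Finset.mul_sum]

theorem sum_orderPattern {k n : ℕ} (p : Fin k ↪ Fin n) (F : (Fin k → Fin k → Bool) → ℕ) :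
    k.factorial * ∑ w : Equiv.Perm (Fin n), F (orderPattern (w ∘ p)) =
      (∑ σ : Equiv.Perm (Fin k), F (orderPattern σ)) * n.factorial := by
  simpa [Fintype.card_perm] using sum_orderPattern_mul p F (fun _ => 1) (fun _ _ _ => rfl)

/-! ### The longest alternating subsequence counts the turning points -/

/-- Whether the word `v` changes direction at position `m + 1`. -/
def turn (v : ℕ → ℕ) (m : ℕ) : ℕ :=
  if decide (v (m + 1) < v m) = decide (v (m + 2) < v (m + 1)) then 0 else 1

/-- One more than the number of changes of direction in `v 0, …, v m`, where the word is
regarded as ascending before its first letter. -/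
def turnLength (v : ℕ → ℕ) : ℕ → ℕ
  | 0 => 1
  | 1 => 1 + if v 1 < v 0 then 1 else 0
  | m + 2 => turnLength v (m + 1) + turn v m

theorem turnLength_le_succ (v : ℕ → ℕ) (m : ℕ) : turnLength v m ≤ turnLength v (m + 1) := by
  cases m <;> simp [turnLength]

theorem turnLength_mono (v : ℕ → ℕ) : Monotone (turnLength v) :=
  monotone_nat_of_le_succ (turnLength_le_succ v)

theorem one_le_turnLength (v : ℕ → ℕ) (m : ℕ) : 1 ≤ turnLength v m :=
  turnLength_mono v (Nat.zero_le m)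

theorem turnLength_congr {v v' : ℕ → ℕ} {m : ℕ} (h : ∀ i ≤ m, v i = v' i) :
    turnLength v m = turnLength v' m := by
  induction m using Nat.twoStepInduction with
  | zero => rfl
  | one => simp [turnLength, h 0 (by omega), h 1 (by omega)]
  | more m _ ih =>
    simp only [turnLength, turn, ih fun i hi => h i (by omega), h m (by omega),
      h (m + 1) (by omega), h (m + 2) (by omega)]

theorem turnLength_succ_le (v : ℕ → ℕ) (m : ℕ) :
    turnLength v (m + 1) ≤ turnLength v m + 1 := by
  cases m with
  | zero => simp only [turnLength]; split_ifs <;> omega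
  | succ m => simp only [turnLength, turn]; split_ifs <;> omega

/-- Every turn flips both the parity and the direction, so parity records the direction of the last
step. -/
theorem even_turnLength_succ (v : ℕ → ℕ) (m : ℕ) :
    Even (turnLength v (m + 1)) ↔ v (m + 1) < v m := by
  induction m with
  | zero =>
    simp only [turnLength]
    split_ifs with h <;> simp [h]
  | succ m ih =>
    simp only [turnLength, turn, decide_eq_decide]
    split_ifs with h
    · rw [add_zero, ih, h]
    · rw [Nat.even_add_one, ih]
      tauto

theorem exists_descent_of_lt {v : ℕ → ℕ} {a b : ℕ} (hab : a ≤ b) (h : v b < v a) :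
    ∃ s, a ≤ s ∧ s < b ∧ v (s + 1) < v s := by
  by_contra! hc
  have : ∀ c, a ≤ c → c ≤ b → v a ≤ v c := by
    intro c hac
    induction c, hac using Nat.le_induction with
    | base => exact fun _ => le_rfl
    | succ c hac ih => exact fun hcb => (ih (by omega)).trans (hc c hac (by omega))
  exact absurd (this b hab le_rfl) (not_le.mpr h)

theorem exists_ascent_of_lt {v : ℕ → ℕ} {a b : ℕ} (hab : a ≤ b) (h : v a < v b) :
    ∃ s, a ≤ s ∧ s < b ∧ v s < v (s + 1) := by
  by_contra! hc
  have : ∀ c, a ≤ c → c ≤ b → v c ≤ v a := by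
    intro c hac
    induction c, hac using Nat.le_induction with
    | base => exact fun _ => le_rfl
    | succ c hac ih => exact fun hcb => (hc c hac (by omega)).trans (ih (by omega))
  exact absurd (this b hab le_rfl) (not_le.mpr h)

/-- Upper bound on alternating subsequences: between consecutive chosen positions some adjacent step
has the required direction, and by parity the count there cannot still be `j + 1`. -/
theorem succ_le_turnLength {v p : ℕ → ℕ} {k : ℕ}
    (hp : ∀ i, i + 1 < k → p i < p (i + 1))
    (hv : ∀ i, i + 1 < k →
      (Even i → v (p (i + 1)) < v (p i)) ∧ (Odd i → v (p i) < v (p (i + 1))))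
    (j : ℕ) (hj : j < k) : j + 1 ≤ turnLength v (p j) := by
  induction j with
  | zero => exact one_le_turnLength v _
  | succ j ih =>
    have ih := ih (by omega)
    have hlt := hp j hj
    have key : ∃ s, p j ≤ s ∧ s < p (j + 1) ∧ (v (s + 1) < v s ↔ Even j) := by
      rcases Nat.even_or_odd j with he | ho
      · obtain ⟨s, h1, h2, h3⟩ := exists_descent_of_lt hlt.le ((hv j hj).1 he)
        exact ⟨s, h1, h2, iff_of_true h3 he⟩
      · obtain ⟨s, h1, h2, h3⟩ := exists_ascent_of_lt hlt.le ((hv j hj).2 ho)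
        exact ⟨s, h1, h2, iff_of_false h3.le.not_gt (Nat.not_even_iff_odd.mpr ho)⟩
    obtain ⟨s, h1, h2, h3⟩ := key
    rw [← even_turnLength_succ] at h3
    have h4 := turnLength_mono v (show p j ≤ s + 1 by omega)
    have h5 := turnLength_mono v (show s + 1 ≤ p (j + 1) by omega)
    have h6 : turnLength v (s + 1) ≠ j + 1 := by
      intro h
      rw [h, Nat.even_add_one] at h3
      tauto
    omega

/-- Greedy construction. Forcing the last term to sit at position `m` is what lets the induction
continue. -/
theorem exists_alternating_turnLength {v : ℕ → ℕ} (hinj : Function.Injective v) (m : ℕ) :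
    ∃ p : ℕ → ℕ, p (turnLength v m - 1) = m ∧
      (∀ i, i + 1 < turnLength v m → p i < p (i + 1)) ∧
      ∀ i, i + 1 < turnLength v m →
        (Even i → v (p (i + 1)) < v (p i)) ∧ (Odd i → v (p i) < v (p (i + 1))) := by
  induction m with
  | zero => exact ⟨fun _ => 0, rfl, by simp [turnLength], by simp [turnLength]⟩
  | succ m ih =>
    obtain ⟨p, hlast, hp, hv⟩ := ih
    have hpos := one_le_turnLength v m
    have hle := turnLength_le_succ v m
    have hle' := turnLength_succ_le v m
    have hpar := even_turnLength_succ v m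
    have hne : v (m + 1) ≠ v m := fun h => by simpa using hinj h
    set L := turnLength v m
    set L' := turnLength v (m + 1)
    have hold : ∀ i, i ≠ L' - 1 → Function.update p (L' - 1) (m + 1) i = p i :=
      fun i hi => Function.update_of_ne hi _ _
    have hnew : Function.update p (L' - 1) (m + 1) (L' - 1) = m + 1 := Function.update_self _ _ _
    -- This one update overwrites the last term if the direction persists (`L' = L`) and appends a
    -- term if it changes (`L' = L + 1`).
    refine ⟨Function.update p (L' - 1) (m + 1), hnew, fun i hi => ?_, fun i hi => ?_⟩
    · rw [hold i (by omega)]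
      by_cases hi' : i + 1 = L' - 1
      · rw [hi', hnew]
        by_cases hL : L' = L
        · have := hp i (by omega)
          rw [hi', hL, hlast] at this
          omega
        · have : i = L - 1 := by omega
          rw [this, hlast]
          omega
      · rw [hold _ hi']
        exact hp i (by omega)
    · rw [hold i (by omega)]
      by_cases hi' : i + 1 = L' - 1
      · have hL'' : L' = i + 2 := by omega
        rw [hi', hnew]
        have hpar' : Even i ↔ v (m + 1) < v m := by
          rw [← hpar, hL'', Nat.even_add]
          simp
        by_cases hL : L' = L
        · have h := hv i (by omega)
          rw [hi', hL, hlast] at h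
          refine ⟨fun he => (hpar'.mp he).trans (h.1 he), fun ho => (h.2 ho).trans ?_⟩
          have := mt hpar'.mpr (Nat.not_even_iff_odd.mpr ho)
          omega
        · have : i = L - 1 := by omega
          rw [← this] at hlast
          rw [hlast]
          refine ⟨hpar'.mp, fun ho => ?_⟩
          have := mt hpar'.mpr (Nat.not_even_iff_odd.mpr ho)
          omega
      · rw [hold _ hi']
        exact hv i (by omega)

/-- The word of a permutation, continued by the identity. -/
def permWord {n : ℕ} (w : Equiv.Perm (Fin n)) (i : ℕ) : ℕ :=
  if h : i < n then (w ⟨i, h⟩ : ℕ) else i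

theorem permWord_coe {n : ℕ} (w : Equiv.Perm (Fin n)) (i : Fin n) :
    permWord w i = (w i : ℕ) := by
  simp [permWord]

theorem permWord_injective {n : ℕ} (w : Equiv.Perm (Fin n)) : Function.Injective (permWord w) := by
  intro i j hij
  unfold permWord at hij
  split_ifs at hij with hi hj hj
  · simpa using w.injective (Fin.ext hij)
  · have := (w ⟨i, hi⟩).isLt
    omega
  · have := (w ⟨j, hj⟩).isLt
    omega
  · exact hij

theorem longestAlternating_eq_turnLength {n : ℕ} (w : Equiv.Perm (Fin (n + 1))) :
    longestAlternating w = turnLength (permWord w) n := by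
  refine (isGreatest_longestAlternating w).unique ⟨?_, ?_⟩
  · obtain ⟨p, hlast, hp, hv⟩ := exists_alternating_turnLength (permWord_injective w) n
    set L := turnLength (permWord w) n
    have hmono : ∀ i j, i < j → j < L → p i < p j := by
      intro i j hij
      induction j, hij using Nat.le_induction with
      | base => exact hp i
      | succ j hij ih => exact fun hj => (ih (by omega)).trans (hp j hj)
    have hlt : ∀ i : Fin L, p i < n + 1 := by
      intro i
      rcases lt_or_eq_of_le (show (i : ℕ) ≤ L - 1 by omega) with h | h
      · have := hmono i (L - 1) h (by omega)
        omega
      · rw [h, hlast]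
        omega
    refine ⟨fun i => ⟨p i, hlt i⟩, fun i j hij => hmono i j hij j.isLt, fun i j hij => ?_⟩
    have h := hv i (by omega)
    rw [hij] at h
    simp only [permWord, hlt, dif_pos] at h
    exact h
  · rintro k ⟨p, hp, halt⟩
    rcases Nat.eq_zero_or_pos k with rfl | hk
    · exact Nat.zero_le _
    let q : ℕ → ℕ := fun i => if h : i < k then (p ⟨i, h⟩ : ℕ) else 0
    have hq : ∀ i (h : i < k), q i = p ⟨i, h⟩ := fun i h => dif_pos h
    have h := succ_le_turnLength (v := permWord w) (p := q) (k := k)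
      (fun i hi => by
        rw [hq i (by omega), hq _ hi]
        exact hp (Fin.mk_lt_mk.mpr (Nat.lt_succ_self i)))
      (fun i hi => by
        rw [hq i (by omega), hq _ hi, permWord_coe, permWord_coe]
        exact halt ⟨i, by omega⟩ ⟨i + 1, hi⟩ rfl)
      (k - 1) (by omega)
    have h2 : q (k - 1) ≤ n := by
      rw [hq (k - 1) (by omega)]
      omega
    have := turnLength_mono (permWord w) h2
    omega

/-! ### Moments -/

/-- The `k` consecutive positions from `m` on. -/
def window {n : ℕ} (m k : ℕ) (h : m + k ≤ n) : Fin k ↪ Fin n where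
  toFun i := ⟨m + i, by omega⟩
  inj' i j hij := by simpa [Fin.ext_iff] using hij

theorem orderPattern_window {n m k : ℕ} (h : m + k ≤ n) (w : Equiv.Perm (Fin n)) (a b : Fin k) :
    orderPattern (w ∘ window m k h) a b =
      decide (permWord w (m + a) < permWord w (m + b)) := by
  have ha : m + (a : ℕ) < n := by omega
  have hb : m + (b : ℕ) < n := by omega
  simp only [permWord, ha, hb, dif_pos, Fin.val_fin_lt]
  rfl

/-- `turn`, read off from an order pattern. -/
def patternTurn {k : ℕ} (a b c : Fin k) (r : Fin k → Fin k → Bool) : ℕ :=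
  if r b a = r c b then 0 else 1

theorem patternTurn_window {n m k : ℕ} (h : m + k ≤ n) (w : Equiv.Perm (Fin n)) (a b c : Fin k)
    (hb : (b : ℕ) = a + 1) (hc : (c : ℕ) = a + 2) :
    patternTurn a b c (orderPattern (w ∘ window m k h)) = turn (permWord w) (m + a) := by
  simp only [patternTurn, orderPattern_window, turn, hb, hc, add_assoc]

theorem permWord_eq_of_lt_window {n m k j : ℕ} (h : m + k ≤ n) (hj : j < m)
    {w w' : Equiv.Perm (Fin n)} (hw : ∀ x ∉ Set.range (window m k h), w x = w' x) :
    permWord w j = permWord w' j := by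
  have hjn : j < n := by omega
  have : (⟨j, hjn⟩ : Fin n) ∉ Set.range (window m k h) := by
    rintro ⟨i, hi⟩
    have : m + (i : ℕ) = j := congrArg Fin.val hi
    omega
  simp [permWord, hjn, hw _ this]

/-- Of the six orders of three letters, only the two monotone ones have no turn. -/
theorem sum_turn {n m : ℕ} (h : m + 3 ≤ n) :
    6 * ∑ w : Equiv.Perm (Fin n), turn (permWord w) m = 4 * n.factorial := by
  have h1 := sum_orderPattern (window m 3 h) (patternTurn 0 1 2)
  have h2 : ∑ σ : Equiv.Perm (Fin 3), patternTurn 0 1 2 (orderPattern σ) = 4 := by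
    decide +kernel
  simp only [patternTurn_window h _ 0 1 2 rfl rfl, h2] at h1
  exact h1

theorem sum_turn_mul_turnLength {n m j : ℕ} (h : m + 3 ≤ n) (hj : j < m) :
    6 * ∑ w : Equiv.Perm (Fin n), turn (permWord w) m * turnLength (permWord w) j =
      4 * ∑ w : Equiv.Perm (Fin n), turnLength (permWord w) j := by
  have h1 := sum_orderPattern_mul (window m 3 h) (patternTurn 0 1 2)
    (fun w => turnLength (permWord w) j) fun w w' hw =>
      turnLength_congr fun i hi => permWord_eq_of_lt_window h (by omega) hw
  have h2 : ∑ σ : Equiv.Perm (Fin 3), patternTurn 0 1 2 (orderPattern σ) = 4 := by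
    decide +kernel
  simp only [patternTurn_window h _ 0 1 2 rfl rfl, h2] at h1
  exact h1

/-- Two adjacent turns mean that four letters alternate: five orders for each starting direction. -/
theorem sum_turn_mul_turn_succ {n m : ℕ} (h : m + 4 ≤ n) :
    24 * ∑ w : Equiv.Perm (Fin n), turn (permWord w) m * turn (permWord w) (m + 1) =
      10 * n.factorial := by
  have h1 := sum_orderPattern (window m 4 h) (fun r => patternTurn 0 1 2 r * patternTurn 1 2 3 r)
  have h2 : ∑ σ : Equiv.Perm (Fin 4),
      patternTurn 0 1 2 (orderPattern σ) * patternTurn 1 2 3 (orderPattern σ) = 10 := by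
    decide +kernel
  simp only [patternTurn_window h _ 0 1 2 rfl rfl, patternTurn_window h _ 1 2 3 rfl rfl, h2] at h1
  exact h1

/-- The two triples share their middle letter, so the turns are still correlated: 54/120 instead of
4/9. -/
theorem sum_turn_mul_turn_add_two {n m : ℕ} (h : m + 5 ≤ n) :
    120 * ∑ w : Equiv.Perm (Fin n), turn (permWord w) m * turn (permWord w) (m + 2) =
      54 * n.factorial := by
  have h1 := sum_orderPattern (window m 5 h) (fun r => patternTurn 0 1 2 r * patternTurn 2 3 4 r)
  have h2 : ∑ σ : Equiv.Perm (Fin 5),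
      patternTurn 0 1 2 (orderPattern σ) * patternTurn 2 3 4 (orderPattern σ) = 54 := by
    decide +kernel
  simp only [patternTurn_window h _ 0 1 2 rfl rfl, patternTurn_window h _ 2 3 4 rfl rfl, h2] at h1
  exact h1

theorem sum_turnLength {n m : ℕ} (h : m + 2 ≤ n) :
    6 * ∑ w : Equiv.Perm (Fin n), turnLength (permWord w) (m + 1) =
      (4 * m + 9) * n.factorial := by
  induction m with
  | zero =>
    have h1 := sum_orderPattern (window 0 2 h) (fun r => 1 + if r 1 0 then 1 else 0)
    have h2 : ∑ σ : Equiv.Perm (Fin 2), (1 + if orderPattern σ 1 0 then 1 else 0) = 3 := by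
      decide +kernel
    rw [h2] at h1
    simp only [orderPattern_window, decide_eq_true_eq] at h1
    change 2 * ∑ w : Equiv.Perm (Fin n), turnLength (permWord w) 1 = _ at h1
    rw [zero_add]
    omega
  | succ m ih =>
    have ih := ih (by omega)
    have ht := sum_turn (n := n) (m := m) (by omega)
    simp only [turnLength, Finset.sum_add_distrib]
    linarith

theorem sum_turnLength_three_sq {n : ℕ} (h : 4 ≤ n) :
    45 * ∑ w : Equiv.Perm (Fin n), turnLength (permWord w) 3 ^ 2 = 390 * n.factorial := by
  have h' : 0 + 4 ≤ n := by omega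
  have h1 := sum_orderPattern (window 0 4 h') (fun r =>
    (1 + (if r 1 0 then 1 else 0) + patternTurn 0 1 2 r + patternTurn 1 2 3 r) ^ 2)
  have h2 : ∑ σ : Equiv.Perm (Fin 4), (1 + (if orderPattern σ 1 0 then 1 else 0) +
      patternTurn 0 1 2 (orderPattern σ) + patternTurn 1 2 3 (orderPattern σ)) ^ 2 = 208 := by
    decide +kernel
  rw [h2] at h1
  simp only [patternTurn_window h' _ 0 1 2 rfl rfl, patternTurn_window h' _ 1 2 3 rfl rfl,
    orderPattern_window, decide_eq_true_eq] at h1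
  change 24 * ∑ w : Equiv.Perm (Fin n), turnLength (permWord w) 3 ^ 2 = _ at h1
  omega

theorem sum_turnLength_sq {n m : ℕ} (h : m + 4 ≤ n) :
    45 * ∑ w : Equiv.Perm (Fin n), turnLength (permWord w) (m + 3) ^ 2 =
      (20 * m ^ 2 + 178 * m + 390) * n.factorial := by
  induction m with
  | zero => simpa using sum_turnLength_three_sq (n := n) (by omega)
  | succ m ih =>
    have ih := ih (by omega)
    have h1 := sum_turn (n := n) (m := m + 2) (by omega)
    have h2 := sum_turn_mul_turnLength (n := n) (m := m + 2) (j := m + 1) (by omega) (by omega)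
    have h3 := sum_turn_mul_turn_succ (n := n) (m := m + 1) (by omega)
    have h4 := sum_turn_mul_turn_add_two (n := n) (m := m) (by omega)
    have h5 := sum_turnLength (n := n) (m := m) (by omega)
    -- The new turn is independent of `turnLength` at `m + 1`; only the two turns in between overlap
    -- its window. This needs the index `m + 1 ≥ 1`, so the recursion starts at index 3, that is,
    -- four letters.
    have hstep : ∀ w : Equiv.Perm (Fin n), turnLength (permWord w) (m + 1 + 3) ^ 2 =
        turnLength (permWord w) (m + 3) ^ 2 +
        2 * (turn (permWord w) (m + 2) * turnLength (permWord w) (m + 1)) +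
        2 * (turn (permWord w) m * turn (permWord w) (m + 2)) +
        2 * (turn (permWord w) (m + 1) * turn (permWord w) (m + 1 + 1)) +
        turn (permWord w) (m + 2) := by
      intro w
      have hsq : turn (permWord w) (m + 2) ^ 2 = turn (permWord w) (m + 2) := by
        unfold turn
        split_ifs <;> rfl
      have e1 : turnLength (permWord w) (m + 1 + 3) =
        turnLength (permWord w) (m + 3) + turn (permWord w) (m + 2) := rfl
      have e2 : turnLength (permWord w) (m + 3) =
        turnLength (permWord w) (m + 1) + turn (permWord w) m + turn (permWord w) (m + 1) := rfl
      rw [e1, add_sq, hsq, e2]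
      ring
    simp only [hstep, Finset.sum_add_distrib, ← Finset.mul_sum]
    linarith

theorem factorialMoment_one_eq {n : ℕ} (h : 2 ≤ n) :
    factorialMoment 1 n = (4 * n + 1) / 6 := by
  obtain ⟨m, rfl⟩ := Nat.exists_eq_add_of_le' h
  have h1 := sum_turnLength (n := m + 2) (m := m) le_rfl
  have hpos : ((m + 2).factorial : ℝ) ≠ 0 := by positivity
  simp only [factorialMoment, Nat.descFactorial_one, longestAlternating_eq_turnLength]
  rify at h1
  rw [div_eq_iff hpos]
  push_cast
  linarith

theorem factorialMoment_two_add_one (n : ℕ) :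
    factorialMoment 2 n + factorialMoment 1 n =
      (∑ w : Equiv.Perm (Fin n), (longestAlternating w : ℝ) ^ 2) / n.factorial := by
  rw [factorialMoment, factorialMoment, ← add_div, ← Finset.sum_add_distrib]
  congr 1
  refine Finset.sum_congr rfl fun w _ => ?_
  rw [Nat.cast_descFactorial_two, Nat.descFactorial_one]
  ring

theorem factorialMoment_two_eq {n : ℕ} (h : 4 ≤ n) :
    factorialMoment 2 n = (40 * (n : ℝ) ^ 2 - 24 * n - 19) / 90 := by
  have h1 := factorialMoment_one_eq (show 2 ≤ n by omega)
  have h2 := factorialMoment_two_add_one n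
  have h3 : (∑ w : Equiv.Perm (Fin n), (longestAlternating w : ℝ) ^ 2) / n.factorial =
      (20 * (n : ℝ) ^ 2 + 18 * n - 2) / 45 := by
    obtain ⟨m, rfl⟩ := Nat.exists_eq_add_of_le' h
    have h4 := sum_turnLength_sq (n := m + 4) (m := m) le_rfl
    have hpos : ((m + 4).factorial : ℝ) ≠ 0 := by positivity
    simp only [longestAlternating_eq_turnLength]
    rify at h4
    rw [div_eq_iff hpos]
    push_cast
    linarith
  rw [h3, h1] at h2
  linarith

theorem integral_uniformOfFintype_perm {n : ℕ} (f : Equiv.Perm (Fin n) → ℝ) :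
    letI : MeasurableSpace (Equiv.Perm (Fin n)) := ⊤
    ∫ w, f w ∂(PMF.uniformOfFintype (Equiv.Perm (Fin n))).toMeasure =
      (∑ w, f w) / n.factorial := by
  let : MeasurableSpace (Equiv.Perm (Fin n)) := ⊤
  rw [PMF.integral_eq_sum]
  simp [Fintype.card_perm, ← Finset.mul_sum, div_eq_inv_mul]

theorem varianceLongestAlternating_eq (n : ℕ) :
    varianceLongestAlternating n =
      factorialMoment 2 n + factorialMoment 1 n - factorialMoment 1 n ^ 2 := by
  let : MeasurableSpace (Equiv.Perm (Fin n)) := ⊤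
  rw [factorialMoment_two_add_one, varianceLongestAlternating, variance_eq_sub MemLp.of_discrete]
  simp only [Pi.pow_apply]
  rw [integral_uniformOfFintype_perm, integral_uniformOfFintype_perm]
  simp only [factorialMoment, Nat.descFactorial_one]

theorem mainTheorem4 :
    (∀ n : ℕ, varianceLongestAlternating n =
      factorialMoment 2 n + factorialMoment 1 n - factorialMoment 1 n ^ 2) ∧
    (∀ n : ℕ, 4 ≤ n →
      factorialMoment 2 n = (40 * (n : ℝ) ^ 2 - 24 * (n : ℝ) - 19) / 90 ∧
      varianceLongestAlternating n = (32 * (n : ℝ) - 13) / 180 ∧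
      varianceLongestAlternating n = 8 / 45 * (n : ℝ) - 13 / 180) := by
  refine ⟨varianceLongestAlternating_eq, fun n hn => ?_⟩
  have h2 := factorialMoment_two_eq hn
  have hv : varianceLongestAlternating n = (32 * (n : ℝ) - 13) / 180 := by
    rw [varianceLongestAlternating_eq, h2, factorialMoment_one_eq (by omega)]
    ring
  refine ⟨h2, hv, ?_⟩
  rw [hv]
  ring
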